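/- A real tree is a metric space $(\mathcal T,d)$ such that for all $x,y\in\mathcal T$: (i) there is a unique isometric map $f_{x,y}:[0,d(x,y)]\to\mathcal T$ with $f_{x,y}(0)=x$ and $f_{x,y}(d(x,y))=y$; its range is denoted $[\![x,y]\!]$; (ii) every continuous injective map $\varphi:[0,1]\to\mathcal T$ with $\varphi(0)=x$, $\varphi(1)=y$ has range $[\![x,y]\!]$. A point $x$ is a leaf if $\mathcal T\setminus\{x\}$ is connected; the skeleton is the set of points that are not leaves. The length measure $\ell$ is the one-dimensional Hausdorff measure restricted to the skeleton, that is, the Borel measure with $\ell([\![x,y]\!])=d(x,y)$ for all $x,y$ that gives no mass to the leaves. Let $\mathcal T$ be a compact real tree with a root $\emptyset\in\mathcal T$, let $m$ be any finite Borel measure on $\mathcal T$ (for instance the mass measure of a tree coded by a continuous height function $\zeta$ supported on $[0,\sigma]$, i.e. the image of Lebesgue measure on $[0,\sigma]$ under the canonical projection), and let $\alpha>0$. On a probability space, let $M$ be a Poisson point measure on $\mathcal T\times[0,\infty)$ with intensity $2\alpha\,\ell(dx)\,dq$. For $x\in\mathcal T$ put $$\theta(x)=\inf\{q>0:\ M([\![\emptyset,x]\!]\times[0,q])>0\}\in[0,\infty],\qquad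 \Theta=\int_{\mathcal T}\theta(x)\,m(dx)\in[0,\infty],$$ and for $x_1,\dots,x_i\in\mathcal T$ let $\mathcal T(x_1,\dots,x_i)=\bigcup_{j=1}^i[\![\emptyset,x_j]\!]$ be the subtree spanned by the root and $x_1,\dots,x_i$. Then $\Theta$ is a random variable (measurable up to a null event) and, for every positive integer $r$, $$\mathbb E[\Theta^r]=\mu_r:=\frac{r!}{(2\alpha)^r}\int_{\mathcal T^r}\frac{m(dx_1)\cdots m(dx_r)}{\prod_{i=1}^r\ell(\mathcal T(x_1,\dots,x_i))},$$ as an identity in $[0,\infty]$, with $1/0=\infty$. Moreover, if $\mu_1=\frac1{2\alpha}\int_{\mathcal T}\frac{m(dx)}{d(\emptyset,x)}<\infty$, then $\Theta<\infty$ almost surely and the law of $\Theta$ is characterized by these moments: a measure $\nu$ on $\mathbb R$ is the law of $\Theta$ if and only if $\nu$ is a probability measure with, for every positive integer $r$, $\mu_r<\infty$, $\int|t|^r\,\nu(dt)<\infty$ and $\int t^r\,\nu(dt)=\mu_r$. (This moment-defined law is Janson's law of the tree.) -/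

import Mathlib

open MeasureTheory ProbabilityTheory Set
open scoped NNReal ENNReal Nat

noncomputable section

namespace RealTree

/-- `f` is an isometric map `[0, d(x,y)] → T` with `f 0 = x` and `f (d(x,y)) = y`. -/
def IsGeodesic {T : Type*} [MetricSpace T] (x y : T) (f : Icc (0 : ℝ) (dist x y) → T) : Prop :=
  Isometry f ∧ f ⟨0, le_rfl, dist_nonneg⟩ = x ∧ f ⟨dist x y, dist_nonneg, le_rfl⟩ = y

/-- The path `⟦x, y⟧`: the range of the geodesic from `x` to `y` (which is unique in a
real tree, so that the union below has a single member). -/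
def arc {T : Type*} [MetricSpace T] (x y : T) : Set T :=
  ⋃ f ∈ {f : Icc (0 : ℝ) (dist x y) → T | IsGeodesic x y f}, range f

/-- Real trees: unique geodesics and no loops. -/
structure IsRealTree (T : Type*) [MetricSpace T] : Prop where
  unique_geodesic : ∀ x y : T, ∃! f : Icc (0 : ℝ) (dist x y) → T, IsGeodesic x y f
  no_loop : ∀ γ : unitInterval → T, Continuous γ → Function.Injective γ →
    range γ = arc (γ 0) (γ 1)

/-- The leaves: points `x` such that `T \ {x}` remains connected. -/
def leaves (T : Type*) [MetricSpace T] : Set T := {x | IsPreconnected ({x}ᶜ : Set T)}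

/-- The skeleton: the points that are not leaves. -/
def skeleton (T : Type*) [MetricSpace T] : Set T := (leaves T)ᶜ

/-- The length measure: one-dimensional Hausdorff measure on the skeleton. In a real tree it is
the Borel measure that gives no mass to the leaves and mass `d(x,y)` to each path `⟦x, y⟧`
(see `lengthMeasure_arc` below). -/
def lengthMeasure (T : Type*) [MetricSpace T] [MeasurableSpace T] [BorelSpace T] : Measure T :=
  (Measure.hausdorffMeasure 1).restrict (skeleton T)

/-- The subtree spanned by the root and the points of `S` (for nonempty `S`):
the union of the paths from the root to the points of `S`. -/
def spannedSubtree {T : Type*} [MetricSpace T] (root : T) (S : Set T) : Set T :=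
  ⋃ x ∈ S, arc root x

/-- `M` is, under `P`, a Poisson point measure with intensity `μ`: a random measure which is
almost surely a countable sum of Dirac masses, such that `M(B)` has the Poisson law of parameter
`μ(B)` whenever `μ(B) < ∞`, and the `M(B_i)` are independent when the `B_i` are disjoint. -/
structure IsPoissonPointMeasure {Ω E : Type*} [MeasurableSpace Ω] [MeasurableSpace E]
    (M : Ω → Measure E) (μ : Measure E) (P : Measure Ω) : Prop where
  measurable : Measurable M
  point : ∀ᵐ ω ∂P, ∃ (s : Set ℕ) (a : s → E), M ω = Measure.sum fun i => Measure.dirac (a i)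
  law : ∀ B : Set E, MeasurableSet B → μ B ≠ ∞ →
    P.map (fun ω => M ω B) =
      (poissonMeasure (μ B).toNNReal).map (fun k : ℕ => (k : ℝ≥0∞))
  indep : ∀ (n : ℕ) (B : Fin n → Set E), (∀ i, MeasurableSet (B i)) →
    Pairwise (fun i j => Disjoint (B i) (B j)) → iIndepFun (fun i ω => M ω (B i)) P

/-- The intensity `2α ℓ(dx) dq` of the marks on `T × [0, ∞)`. -/
def markIntensity (T : Type*) [MetricSpace T] [MeasurableSpace T] [BorelSpace T] (α : ℝ) :
    Measure (T × ℝ≥0) :=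
  ENNReal.ofReal (2 * α) •
    (lengthMeasure T).prod ((volume : Measure ℝ).comap ((↑) : ℝ≥0 → ℝ))

/-- `θ(x) = inf {q > 0 : M(⟦∅, x⟧ × [0, q]) > 0}`, with value `∞` if there is no such `q`. -/
def theta {T : Type*} [MetricSpace T] [MeasurableSpace T] (root : T)
    (M : Measure (T × ℝ≥0)) (x : T) : ℝ≥0∞ :=
  ⨅ (q : ℝ≥0) (_ : 0 < q ∧ 0 < M (arc root x ×ˢ Iic q)), (q : ℝ≥0∞)

/-- `Θ = ∫ θ(x) m(dx)`. -/
def Theta {T : Type*} [MetricSpace T] [MeasurableSpace T] (root : T) (m : Measure T)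
    (M : Measure (T × ℝ≥0)) : ℝ≥0∞ :=
  ∫⁻ x, theta root M x ∂m

/-- `r! / (2α)^r ∫_{T^r} ∏_i m(dx_i) / ∏_{i=1}^r ℓ(T(x_1, …, x_i))`, with `1 / 0 = ∞`. -/
def jansonMoment {T : Type*} [MetricSpace T] [MeasurableSpace T] [BorelSpace T] (root : T)
    (m : Measure T) (α : ℝ) (r : ℕ) : ℝ≥0∞ :=
  (r ! : ℝ≥0∞) / ENNReal.ofReal (2 * α) ^ r *
    ∫⁻ x : Fin r → T, 1 / ∏ i : Fin r, lengthMeasure T (spannedSubtree root (x '' Iic i))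
      ∂(Measure.pi fun _ => m)

/-- A probability law on `ℝ` all of whose moments are finite and given by `jansonMoment`. -/
structure IsJansonLaw {T : Type*} [MetricSpace T] [MeasurableSpace T] [BorelSpace T] (root : T)
    (m : Measure T) (α : ℝ) (ν : Measure ℝ) : Prop where
  isProbabilityMeasure : IsProbabilityMeasure ν
  moment_ne_top : ∀ r : ℕ, 0 < r → jansonMoment root m α r ≠ ∞
  integrable : ∀ r : ℕ, 0 < r → Integrable (fun t : ℝ => t ^ r) ν
  moment_eq : ∀ r : ℕ, 0 < r → ∫ t, t ^ r ∂ν = (jansonMoment root m α r).toReal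

/-! ### The length measure of a path -/

section Length

variable {T : Type*} [MetricSpace T]

theorem IsRealTree.exists_geodesic (hT : IsRealTree T) (x y : T) :
    ∃ F : ℝ → T, Continuous F ∧ F 0 = x ∧ F (dist x y) = y ∧
      (∀ s ∈ Icc (0 : ℝ) (dist x y), ∀ t ∈ Icc (0 : ℝ) (dist x y),
        dist (F s) (F t) = |s - t|) ∧
      arc x y = F '' Icc (0 : ℝ) (dist x y) := by
  obtain ⟨f, hf, hu⟩ := hT.unique_geodesic x y
  have h0 : (0 : ℝ) ≤ dist x y := dist_nonneg
  have hF : ∀ s (hs : s ∈ Icc (0 : ℝ) (dist x y)), IccExtend h0 f s = f ⟨s, hs⟩ :=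
    fun s hs => IccExtend_of_mem h0 f hs
  refine ⟨IccExtend h0 f, hf.1.continuous.Icc_extend', ?_, ?_, ?_, ?_⟩
  · rw [hF 0 ⟨le_rfl, h0⟩]; exact hf.2.1
  · rw [hF _ ⟨h0, le_rfl⟩]; exact hf.2.2
  · intro s hs t ht
    rw [hF s hs, hF t ht, hf.1.dist_eq, Subtype.dist_eq, Real.dist_eq]
  · ext p
    simp only [arc, mem_ofPred_eq, mem_iUnion, mem_range, mem_image, exists_prop]
    constructor
    · rintro ⟨g, hg, ⟨t, rfl⟩⟩
      rw [hu g hg]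
      exact ⟨t, t.2, hF t t.2⟩
    · rintro ⟨t, ht, rfl⟩
      exact ⟨f, hf, ⟨t, ht⟩, (hF t ht).symm⟩

theorem IsRealTree.isCompact_arc (hT : IsRealTree T) (x y : T) : IsCompact (arc x y) := by
  obtain ⟨F, hc, -, -, -, h⟩ := hT.exists_geodesic x y
  rw [h]
  exact isCompact_Icc.image hc

theorem IsRealTree.dist_le_of_mem_arc (hT : IsRealTree T) {x y p : T} (hp : p ∈ arc x y) :
    dist x p ≤ dist x y ∧ dist p y ≤ dist x y := by
  obtain ⟨F, -, h0, h1, hd, h⟩ := hT.exists_geodesic x y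
  rw [h] at hp
  obtain ⟨t, ht, rfl⟩ := hp
  have hn : (0 : ℝ) ≤ dist x y := dist_nonneg
  have e1 := hd 0 ⟨le_rfl, hn⟩ t ht
  have e2 := hd t ht _ ⟨hn, le_rfl⟩
  rw [h0] at e1
  rw [h1] at e2
  rw [e1, e2, abs_of_nonpos (by linarith [ht.1]), abs_of_nonpos (by linarith [ht.2])]
  constructor <;> linarith [ht.1, ht.2]

theorem IsRealTree.left_mem_arc (hT : IsRealTree T) (x y : T) : x ∈ arc x y := by
  obtain ⟨F, -, h0, -, -, h⟩ := hT.exists_geodesic x y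
  rw [h]
  exact ⟨0, ⟨le_rfl, dist_nonneg⟩, h0⟩

theorem IsRealTree.right_mem_arc (hT : IsRealTree T) (x y : T) : y ∈ arc x y := by
  obtain ⟨F, -, -, h1, -, h⟩ := hT.exists_geodesic x y
  rw [h]
  exact ⟨_, ⟨dist_nonneg, le_rfl⟩, h1⟩

theorem IsRealTree.arc_subset (hT : IsRealTree T) (x y z : T) :
    arc x z ⊆ arc x y ∪ arc y z := by
  obtain ⟨F, Fc, F0, F1, Fd, hF⟩ := hT.exists_geodesic x y
  obtain ⟨G, Gc, G0, G1, Gd, hG⟩ := hT.exists_geodesic y z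
  set a := dist x y
  set b := dist y z
  have ha : 0 ≤ a := dist_nonneg
  have hb : 0 ≤ b := dist_nonneg
  have Finj : ∀ s ∈ Icc 0 a, ∀ t ∈ Icc 0 a, F s = F t → s = t := by
    intro s hs t ht h
    have := Fd s hs t ht
    rw [h, dist_self] at this
    linarith [abs_eq_zero.1 this.symm]
  have Ginj : ∀ s ∈ Icc 0 b, ∀ t ∈ Icc 0 b, G s = G t → s = t := by
    intro s hs t ht h
    have := Gd s hs t ht
    rw [h, dist_self] at this
    linarith [abs_eq_zero.1 this.symm]
  set S : Set ℝ := Icc 0 a ∩ F ⁻¹' (arc y z)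
  have hSc : IsCompact S :=
    isCompact_Icc.inter_right ((hT.isCompact_arc y z).isClosed.preimage Fc)
  have hSn : S.Nonempty := ⟨a, ⟨ha, le_rfl⟩, by
    change F a ∈ arc y z
    rw [F1]; exact hT.left_mem_arc y z⟩
  obtain ⟨u, ⟨hu, hu'⟩, hmin⟩ := hSc.exists_isLeast hSn
  have hu2 : F u ∈ arc y z := hu'
  rw [hG] at hu2
  obtain ⟨v, hv, hv'⟩ := hu2
  set H : ℝ → T := fun t => if t ≤ u then F t else G (v + (t - u))
  have Hc : Continuous H := by
    refine Continuous.if_le Fc (Gc.comp (by fun_prop)) continuous_id continuous_const ?_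
    intro t ht
    change t = u at ht
    subst ht
    simp [hv']
  set L := u + (b - v)
  have hL : 0 ≤ L := by linarith [hu.1, hv.2]
  have H0 : H 0 = x := by
    simp only [H, if_pos hu.1, F0]
  have H1 : H L = z := by
    by_cases h : L ≤ u
    · have : v = b := le_antisymm hv.2 (by simp only [L] at h; linarith)
      have hLu : L = u := by simp only [L]; linarith
      simp only [H, hLu, le_refl, if_true]
      rw [← hv', this, G1]
    · simp only [H, if_neg h]
      rw [← G1]
      congr 1
      simp only [L]; ring
  have Hmem : ∀ t ∈ Icc 0 L, H t ∈ arc x y ∪ arc y z := by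
    intro t ht
    by_cases h : t ≤ u
    · left
      rw [hF]
      exact ⟨t, ⟨ht.1, h.trans hu.2⟩, by simp only [H, if_pos h]⟩
    · right
      rw [hG]
      refine ⟨v + (t - u), ⟨?_, ?_⟩, by simp only [H, if_neg h]⟩
      · linarith [hv.1]
      · have := ht.2
        simp only [L] at this
        linarith
  have key : ∀ s ∈ Icc 0 L, ∀ t ∈ Icc 0 L, s ≤ u → u < t → H s = H t → False := by
    intro s hs t ht hsu htu h
    have hm : v + (t - u) ∈ Icc 0 b := by
      have := ht.2
      simp only [L] at this
      constructor <;> linarith [hv.1]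
    simp only [H, if_pos hsu, if_neg (not_le.2 htu)] at h
    have hsS : s ∈ S := by
      refine ⟨⟨hs.1, hsu.trans hu.2⟩, ?_⟩
      change F s ∈ arc y z
      rw [h, hG]
      exact ⟨_, hm, rfl⟩
    have hsu' : s = u := le_antisymm hsu (hmin hsS)
    rw [hsu', ← hv'] at h
    have := Ginj _ hv _ hm h
    linarith
  have Hinj : ∀ s ∈ Icc 0 L, ∀ t ∈ Icc 0 L, H s = H t → s = t := by
    intro s hs t ht h
    by_cases h1 : s ≤ u <;> by_cases h2 : t ≤ u
    · simp only [H, if_pos h1, if_pos h2] at h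
      exact Finj _ ⟨hs.1, h1.trans hu.2⟩ _ ⟨ht.1, h2.trans hu.2⟩ h
    · exact (key s hs t ht h1 (not_le.1 h2) h).elim
    · exact (key t ht s hs h2 (not_le.1 h1) h.symm).elim
    · simp only [H, if_neg h1, if_neg h2] at h
      have e1 := hs.2
      have e2 := ht.2
      simp only [L] at e1 e2
      have := Ginj _ ⟨by linarith [hv.1], by linarith⟩ _ ⟨by linarith [hv.1], by linarith⟩ h
      linarith
  rcases hL.eq_or_lt with hL0 | hL0
  · have hxz : x = z := by rw [← H0, ← H1, ← hL0]
    intro p hp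
    have := (hT.dist_le_of_mem_arc hp).1
    rw [hxz, dist_self] at this
    have hzp : z = p := dist_le_zero.1 this
    right
    rw [← hzp]
    exact hT.right_mem_arc y z
  · have hmemL : ∀ t : unitInterval, L * (t : ℝ) ∈ Icc 0 L := fun t =>
      ⟨mul_nonneg hL t.2.1, mul_le_of_le_one_right hL t.2.2⟩
    have := hT.no_loop (fun t => H (L * (t : ℝ))) (Hc.comp (by fun_prop)) (by
      intro s t h
      have := Hinj _ (hmemL s) _ (hmemL t) h
      exact Subtype.ext (mul_left_cancel₀ hL0.ne' this))
    simp only [Icc.coe_zero, mul_zero, Icc.coe_one, mul_one, H0, H1] at this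
    rw [← this]
    rintro _ ⟨t, rfl⟩
    exact Hmem _ (hmemL t)

theorem IsRealTree.mem_skeleton (hT : IsRealTree T) {x y z : T} (hz : z ∈ arc x y)
    (hx : z ≠ x) (hy : z ≠ y) : z ∈ skeleton T := by
  intro hl
  have hl' : IsPreconnected ({z}ᶜ : Set T) := hl
  have near : ∀ w w' : T, dist w w' < dist w z → z ∉ arc w w' ∧ z ∉ arc w' w := by
    intro w w' h
    refine ⟨fun hh => ?_, fun hh => ?_⟩
    · exact absurd (hT.dist_le_of_mem_arc hh).1 (not_le.2 h)
    · have := (hT.dist_le_of_mem_arc hh).2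
      rw [dist_comm z w, dist_comm w' w] at this
      exact absurd this (not_le.2 h)
  have hU : IsOpen {w : T | z ∉ arc x w} := by
    rw [Metric.isOpen_iff]
    intro w hw
    have hwz : w ≠ z := fun h => hw (h ▸ hT.right_mem_arc x w)
    refine ⟨dist w z, dist_pos.2 hwz, fun w' hw' hc => ?_⟩
    rw [Metric.mem_ball, dist_comm] at hw'
    rcases hT.arc_subset x w w' hc with h | h
    · exact hw h
    · exact (near w w' hw').1 h
  have hV : IsOpen {w : T | w ≠ z ∧ z ∈ arc x w} := by
    rw [Metric.isOpen_iff]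
    rintro w ⟨hwz, hw⟩
    refine ⟨dist w z, dist_pos.2 hwz, fun w' hw' => ?_⟩
    rw [Metric.mem_ball, dist_comm] at hw'
    refine ⟨fun h => ?_, ?_⟩
    · rw [h] at hw'
      exact lt_irrefl _ hw'
    · rcases hT.arc_subset x w' w hw with h | h
      · exact h
      · exact absurd h (near w w' hw').2
  obtain ⟨w, -, hw1, hw2⟩ := hl' _ _ hU hV
    (fun w hw => by
      by_cases h : z ∈ arc x w
      · exact Or.inr ⟨hw, h⟩
      · exact Or.inl h)
    ⟨x, hx.symm, fun h => hx (by
      have := (hT.dist_le_of_mem_arc h).1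
      rw [dist_self] at this
      exact (dist_le_zero.1 this).symm)⟩
    ⟨y, hy.symm, hy.symm, hz⟩
  exact hw1 hw2.2

variable [MeasurableSpace T] [BorelSpace T]

/-- The defining property of the length measure: `ℓ(⟦x, y⟧) = d(x, y)`. -/
theorem lengthMeasure_arc (hT : IsRealTree T) (x y : T) :
    lengthMeasure T (arc x y) = edist x y := by
  have hH : (Measure.hausdorffMeasure 1 : Measure T) (arc x y) = edist x y := by
    obtain ⟨f, hf, hu⟩ := hT.unique_geodesic x y
    have e : arc x y = f '' univ := by
      ext p
      simp only [arc, mem_ofPred_eq, mem_iUnion, exists_prop, image_univ]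
      exact ⟨fun ⟨g, hg, hp⟩ => hu g hg ▸ hp, fun hp => ⟨f, hf, hp⟩⟩
    rw [e, hf.1.hausdorffMeasure_image (Or.inl zero_le_one),
      ← (isometry_subtype_coe (s := Icc (0 : ℝ) (dist x y))).hausdorffMeasure_image
        (Or.inl zero_le_one), image_univ, Subtype.range_coe, hausdorffMeasure_real,
      Real.volume_Icc, sub_zero, edist_dist]
  have hm : MeasurableSet (arc x y) := (hT.isCompact_arc x y).isClosed.measurableSet
  rw [lengthMeasure, Measure.restrict_apply hm, ← hH]
  refine le_antisymm (measure_mono inter_subset_left) ?_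
  have hsub : arc x y ⊆ (arc x y ∩ skeleton T) ∪ {x, y} := by
    intro z hz
    by_cases h1 : z = x
    · exact Or.inr (Or.inl h1)
    by_cases h2 : z = y
    · exact Or.inr (Or.inr h2)
    exact Or.inl ⟨hz, hT.mem_skeleton hz h1 h2⟩
  have : NullSingletonClass (Measure.hausdorffMeasure 1 : Measure T) :=
    Measure.nullSingletonClass_hausdorff T one_pos
  have hnull : (Measure.hausdorffMeasure 1 : Measure T) {x, y} = 0 :=
    (toFinite {x, y}).measure_zero _
  calc (Measure.hausdorffMeasure 1 : Measure T) (arc x y)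
      ≤ _ := measure_mono hsub
    _ ≤ _ := measure_union_le _ _
    _ = _ := by rw [hnull, add_zero]

end Length

end RealTree

end

/-! Let Y(t) be the `m`-mass of the points x whose path from the root carries no mark of level at
most t. For fixed x the levels without such a mark form an interval starting at 0 of length θ(x)
(empty if θ(x) = 0), so Fubini gives Θ = ∫ Y(t) dt. The r-th power of this integral is r! times the
integral over t_r < ⋯ < t_1 of Y(t_1)⋯Y(t_r), hence of the indicators that no mark falls in the
union of the ⟦∅, x_i⟧ × [0, t_i], integrated also over `m`^r
(`setLIntegral_pow_eq_lintegral_chain`).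

The Poisson law gives that void event the probability exp(-intensity). At a level strictly between
t_(i+1) and t_i, with t_(r+1) = 0, the union has section T(x_1, …, x_i). The intensity is therefore
the sum of 2α ℓ(T(x_1, …, x_i)) (t_i - t_(i+1)), and integrating out the gaps gives the product of
the 1 / (2α ℓ(T(x_1, …, x_i))), infinite when a length vanishes. This is
`lintegral_indicator_mul_chain`, and `lintegral_Theta_pow` follows.

Since T(x_1, …, x_i) contains ⟦∅, x_i⟧, the moments satisfy μ_r ≤ r! μ_1^r (`jansonMoment_le`). If
μ_1 is finite, the moment generating function is then finite near 0, and the moments determine the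
law (`eq_of_moments_eq`).

Fubini needs joint measurability of the void events in x, t and ω, with a single null set for all x
and t; `exists_measurableSet_noMark` supplies it. -/

namespace RealTree

/-! ### Lebesgue measure on the half-line -/

/-- Lebesgue measure on `[0, ∞)`. -/
noncomputable def halfLine : Measure ℝ≥0 := (volume : Measure ℝ).comap ((↑) : ℝ≥0 → ℝ)

theorem measurableEmbedding_nnreal_coe : MeasurableEmbedding ((↑) : ℝ≥0 → ℝ) :=
  MeasurableEmbedding.subtype_coe measurableSet_Ici

theorem halfLine_apply (s : Set ℝ≥0) : halfLine s = volume (((↑) : ℝ≥0 → ℝ) '' s) :=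
  measurableEmbedding_nnreal_coe.comap_apply _ _

instance : NullSingletonClass halfLine where
  measure_singleton x := by simp [halfLine_apply]

theorem coe_image_Icc (s t : ℝ≥0) : ((↑) : ℝ≥0 → ℝ) '' Icc s t = Icc (s : ℝ) t := by
  ext u
  simp only [mem_image, mem_Icc]
  constructor
  · rintro ⟨v, hv, rfl⟩
    exact_mod_cast hv
  · rintro ⟨h1, h2⟩
    exact ⟨⟨u, s.2.trans h1⟩, ⟨h1, h2⟩, rfl⟩

theorem coe_image_Ioi (s : ℝ≥0) : ((↑) : ℝ≥0 → ℝ) '' Ioi s = Ioi (s : ℝ) := by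
  ext u
  simp only [mem_image, mem_Ioi]
  constructor
  · rintro ⟨v, hv, rfl⟩
    exact_mod_cast hv
  · intro h
    exact ⟨⟨u, s.2.trans h.le⟩, h, rfl⟩

theorem halfLine_Icc (s t : ℝ≥0) : halfLine (Icc s t) = (t - s : ℝ≥0) := by
  rw [halfLine_apply, coe_image_Icc, Real.volume_Icc, ENNReal.ofReal, NNReal.sub_def]

theorem halfLine_Ioc (s t : ℝ≥0) : halfLine (Ioc s t) = (t - s : ℝ≥0) := by
  rw [measure_congr Ioc_ae_eq_Icc, halfLine_Icc]

theorem halfLine_Iic (t : ℝ≥0) : halfLine (Iic t) = t := by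
  have : Iic t = Icc 0 t := by ext; simp
  rw [this, halfLine_Icc, tsub_zero]

instance : SigmaFinite halfLine := by
  refine ⟨⟨⟨fun n : ℕ => Iic (n : ℝ≥0), fun _ => trivial, fun n => ?_, ?_⟩⟩⟩
  · rw [halfLine_Iic]
    exact ENNReal.coe_lt_top
  · refine iUnion_eq_univ_iff.2 fun t => ?_
    exact exists_nat_ge t

theorem setLIntegral_halfLine_Ioi (f : ℝ → ℝ≥0∞) (s : ℝ≥0) :
    ∫⁻ t in Ioi s, f t ∂halfLine = ∫⁻ t in Ioi (s : ℝ), f t := by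
  have h := measurableEmbedding_nnreal_coe
  rw [halfLine, h.restrict_comap, ← h.lintegral_map, h.map_comap, coe_image_Ioi,
    Measure.restrict_restrict h.measurableSet_range]
  congr 2
  ext u
  simp only [mem_inter_iff, mem_Ioi, mem_range]
  exact ⟨fun h => h.2, fun h => ⟨⟨⟨u, s.2.trans (le_of_lt h)⟩, rfl⟩, h⟩⟩

/-- This integrates out one gap between consecutive levels, at rate `c`. The case `c = 0`, where
both sides are infinite, is what makes the moment identity valid in [0, ∞]. -/
theorem setLIntegral_exp_neg_Ioi (a c s : ℝ≥0) :
    ∫⁻ t in Ioi s, ENNReal.ofReal (Real.exp (-((a + c * (t - s) : ℝ≥0) : ℝ))) ∂halfLine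
      = ENNReal.ofReal (Real.exp (-(a : ℝ))) * (c : ℝ≥0∞)⁻¹ := by
  have e : ∫⁻ t in Ioi s, ENNReal.ofReal (Real.exp (-((a + c * (t - s) : ℝ≥0) : ℝ))) ∂halfLine
      = ∫⁻ t in Ioi (s : ℝ), ENNReal.ofReal (Real.exp (-(a : ℝ) + c * s) * Real.exp (-c * t)) := by
    rw [← setLIntegral_halfLine_Ioi]
    refine setLIntegral_congr_fun measurableSet_Ioi fun t ht => ?_
    have : s ≤ t := le_of_lt ht
    rw [← Real.exp_add]
    congr 2
    push_cast [this]
    ring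
  rw [e]
  rcases eq_or_ne c 0 with rfl | hc
  · simp [ENNReal.mul_top, Real.exp_pos]
  · have hc' : (0 : ℝ) < c := by positivity
    rw [← ofReal_integral_eq_lintegral_ofReal, integral_const_mul,
      integral_exp_mul_Ioi (by linarith)]
    · rw [← ENNReal.coe_inv hc, ← ENNReal.ofReal_coe_nnreal, ← ENNReal.ofReal_mul (by positivity)]
      congr 1
      rw [neg_div_neg_eq, mul_div_assoc', ← Real.exp_add, NNReal.coe_inv, div_eq_mul_inv]
      congr 2
      ring
    · exact (integrableOn_exp_mul_Ioi (by linarith) _).const_mul _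
    · exact Filter.Eventually.of_forall fun t => by positivity

/-- The measure of a lower set of the half-line is the infimum of its complement. -/
theorem halfLine_lowerSet {S : Set ℝ≥0} (hS : IsLowerSet S) :
    halfLine S = ⨅ (q : ℝ≥0) (_ : 0 < q ∧ q ∉ S), (q : ℝ≥0∞) := by
  refine le_antisymm ?_ ?_
  · refine le_iInf₂ fun q hq => ?_
    rw [← halfLine_Iic]
    refine measure_mono fun t ht => ?_
    by_contra h
    exact hq.2 (hS (not_le.1 h).le ht)
  · refine ENNReal.le_of_forall_nnreal_lt fun t ht => ?_
    -- The infimum runs over positive `q` only, so it does not tell whether 0 belongs to `S`.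
    rcases eq_or_ne t 0 with rfl | h0
    · simp
    rw [← halfLine_Iic]
    have : t ∈ S := by
      by_contra h
      exact absurd (iInf₂_le (f := fun (q : ℝ≥0) (_ : 0 < q ∧ q ∉ S) => (q : ℝ≥0∞)) t
        ⟨pos_iff_ne_zero.2 h0, h⟩) (not_le.2 ht)
    exact measure_mono fun u hu => hS hu this

/-- The change of variables `d (ρ(t, ∞))^(r+1) = -(r+1) ρ(t, ∞)^r dρ`. -/
theorem measure_Ioi_pow_succ (ρ : Measure ℝ≥0) [SFinite ρ] [NullSingletonClass ρ] (r : ℕ)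
    (s : ℝ≥0) : ρ (Ioi s) ^ (r + 1) = (r + 1) * ∫⁻ t in Ioi s, ρ (Ioi t) ^ r ∂ρ := by
  have hI : Measurable fun t => ρ (Ioi t) :=
    Antitone.measurable fun a b h => measure_mono (Ioi_subset_Ioi h)
  induction r generalizing s with
  | zero => simp
  | succ r ih =>
    -- The splitting ρ(s, ∞) = ρ(t, ∞) + ρ(s, t] avoids subtraction, so infinite values are allowed.
    -- The second term becomes an integral over u in (s, t], ready for exchanging t and u; the
    -- induction hypothesis then applies on (u, ∞).
    have hsplit : ∀ t ∈ Ioi s, ρ (Ioi t) ^ r * ρ (Ioi s)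
        = ρ (Ioi t) ^ (r + 1) + ∫⁻ u in Ioi s, (Ici u).indicator (fun t => ρ (Ioi t) ^ r) t ∂ρ := by
      intro t ht
      have h1 : ρ (Ioi s) = ρ (Ioi t) + ρ (Ioc s t) := by
        rw [add_comm, ← measure_union (Ioc_disjoint_Ioi le_rfl) measurableSet_Ioi,
          Ioc_union_Ioi_eq_Ioi (le_of_lt ht)]
      have h2 : ∫⁻ u in Ioi s, (Ici u).indicator (fun t => ρ (Ioi t) ^ r) t ∂ρ
          = ρ (Ioi t) ^ r * ρ (Ioc s t) := by
        have : ∀ u, (Ici u).indicator (fun t => ρ (Ioi t) ^ r) t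
            = (Iic t).indicator (fun _ => ρ (Ioi t) ^ r) u := fun u => by
          simp [indicator]
        simp_rw [this]
        rw [lintegral_indicator measurableSet_Iic, Measure.restrict_restrict measurableSet_Iic,
          setLIntegral_const, inter_comm, Ioi_inter_Iic]
      rw [h2, h1]
      ring
    have hmeas : Measurable (Function.uncurry fun t u =>
        (Ici u).indicator (fun t => ρ (Ioi t) ^ r) t) := by
      have : (Function.uncurry fun t u => (Ici u).indicator (fun t => ρ (Ioi t) ^ r) t)
          = {p : ℝ≥0 × ℝ≥0 | p.2 ≤ p.1}.indicator (fun p => ρ (Ioi p.1) ^ r) := by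
        ext ⟨t, u⟩
        simp [indicator]
      rw [this]
      exact ((hI.comp measurable_fst).pow_const _).indicator
        (measurableSet_le measurable_snd measurable_fst)
    have hswap : ∫⁻ t in Ioi s, ∫⁻ u in Ioi s, (Ici u).indicator (fun t => ρ (Ioi t) ^ r) t ∂ρ ∂ρ
        = ∫⁻ u in Ioi s, ∫⁻ t in Ioi u, ρ (Ioi t) ^ r ∂ρ ∂ρ := by
      rw [lintegral_lintegral_swap hmeas.aemeasurable]
      refine setLIntegral_congr_fun measurableSet_Ioi fun u hu => ?_
      rw [lintegral_indicator measurableSet_Ici, Measure.restrict_restrict measurableSet_Ici,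
        inter_eq_left.2 (Ici_subset_Ioi.2 hu)]
      exact setLIntegral_congr Ioi_ae_eq_Ici.symm
    have hind : (r + 1 : ℝ≥0∞) * ∫⁻ u in Ioi s, ∫⁻ t in Ioi u, ρ (Ioi t) ^ r ∂ρ ∂ρ
        = ∫⁻ u in Ioi s, ρ (Ioi u) ^ (r + 1) ∂ρ := by
      rw [← lintegral_const_mul' _ _ (by finiteness)]
      simp_rw [← ih]
    have hmain : (∫⁻ t in Ioi s, ρ (Ioi t) ^ r ∂ρ) * ρ (Ioi s)
        = ∫⁻ t in Ioi s, ρ (Ioi t) ^ (r + 1) ∂ρ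
          + ∫⁻ u in Ioi s, ∫⁻ t in Ioi u, ρ (Ioi t) ^ r ∂ρ ∂ρ := by
      rw [← lintegral_mul_const _ (hI.pow_const _), setLIntegral_congr_fun measurableSet_Ioi hsplit,
        lintegral_add_left (hI.pow_const _), hswap]
    rw [pow_succ, ih, mul_assoc, hmain, mul_add, hind]
    push_cast
    ring

/-! ### The moment problem -/

/-- The series of cosh has only even powers, hence nonnegative terms even though `ν` may charge
negative numbers. Integrating term by term, the factorials cancel and a geometric series of ratio
(ac)² remains. -/
theorem integrable_cosh_of_moment_le {ν : Measure ℝ} [IsProbabilityMeasure ν] {c : ℝ}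
    (hint : ∀ r : ℕ, 0 < r → Integrable (fun t : ℝ => t ^ r) ν)
    (hmom : ∀ r : ℕ, 0 < r → ∫ t, t ^ r ∂ν ≤ r ! * c ^ r) {a : ℝ} (ha : 0 ≤ a) (hc : 0 ≤ c)
    (hac : a * c < 1) : Integrable (fun t => Real.cosh (a * t)) ν := by
  have hint' : ∀ r : ℕ, Integrable (fun t : ℝ => t ^ r) ν := fun r => by
    rcases r.eq_zero_or_pos with rfl | h
    · simp
    · exact hint r h
  have hmom' : ∀ r : ℕ, ∫ t, t ^ r ∂ν ≤ r ! * c ^ r := fun r => by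
    rcases r.eq_zero_or_pos with rfl | h
    · simp
    · exact hmom r h
  refine ⟨by fun_prop, ?_⟩
  rw [hasFiniteIntegral_iff_ofReal (Filter.Eventually.of_forall fun t => (Real.cosh_pos _).le)]
  have hs : ∀ t, ENNReal.ofReal (Real.cosh (a * t))
      = ∑' n : ℕ, ENNReal.ofReal ((a * t) ^ (2 * n) / (2 * n)!) := fun t => by
    have h := Real.hasSum_cosh (a * t)
    rw [← h.tsum_eq, ENNReal.ofReal_tsum_of_nonneg _ h.summable]
    intro n
    have : 0 ≤ (a * t) ^ (2 * n) := (even_two_mul n).pow_nonneg _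
    positivity
  have hterm : ∀ n : ℕ, ∫⁻ t, ENNReal.ofReal ((a * t) ^ (2 * n) / (2 * n)!) ∂ν
      ≤ ENNReal.ofReal (((a * c) ^ 2) ^ n) := fun n => by
    rw [← ofReal_integral_eq_lintegral_ofReal]
    · refine ENNReal.ofReal_le_ofReal ?_
      simp_rw [mul_pow a, mul_div_assoc]
      rw [integral_const_mul, integral_div]
      have h1 := hmom' (2 * n)
      have h2 : (∫ t, t ^ (2 * n) ∂ν) / (2 * n)! ≤ c ^ (2 * n) := by
        rw [div_le_iff₀ (by positivity)]
        exact h1.trans_eq (mul_comm _ _)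
      calc a ^ (2 * n) * ((∫ t, t ^ (2 * n) ∂ν) / (2 * n)!)
          ≤ a ^ (2 * n) * c ^ (2 * n) := mul_le_mul_of_nonneg_left h2 (by positivity)
        _ = (a ^ 2 * c ^ 2) ^ n := by rw [← mul_pow, ← mul_pow, ← pow_mul, mul_pow]
    · simp_rw [mul_pow a]
      exact ((hint' _).const_mul _).div_const _
    · refine Filter.Eventually.of_forall fun t => ?_
      have : 0 ≤ (a * t) ^ (2 * n) := (even_two_mul n).pow_nonneg _
      simp only [Pi.zero_apply]
      positivity
  simp_rw [hs]
  rw [lintegral_tsum fun n => by fun_prop]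
  refine (ENNReal.tsum_le_tsum hterm).trans_lt ?_
  have hsum : Summable fun n : ℕ => ((a * c) ^ 2) ^ n :=
    summable_geometric_of_lt_one (by positivity) (by
      have : 0 ≤ a * c := mul_nonneg ha hc
      nlinarith)
  rw [← ENNReal.ofReal_tsum_of_nonneg (fun n => by positivity) hsum]
  exact ENNReal.ofReal_lt_top

theorem Ioo_subset_integrableExpSet {ν : Measure ℝ} [IsProbabilityMeasure ν] {c : ℝ}
    (hint : ∀ r : ℕ, 0 < r → Integrable (fun t : ℝ => t ^ r) ν)
    (hmom : ∀ r : ℕ, 0 < r → ∫ t, t ^ r ∂ν ≤ r ! * c ^ r) (hc : 0 < c) :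
    Ioo (-(c⁻¹)) c⁻¹ ⊆ integrableExpSet id ν := by
  intro a ha
  have h1 : |a| * c < 1 := by
    rw [← lt_div_iff₀ hc, one_div]
    exact abs_lt.2 ha
  have h2 := integrable_cosh_of_moment_le hint hmom (abs_nonneg a) hc.le h1
  refine (h2.const_mul 2).mono' (by fun_prop) (Filter.Eventually.of_forall fun t => ?_)
  rw [Real.norm_eq_abs, Real.abs_exp, ← Real.cosh_abs, abs_mul, abs_abs, ← abs_mul, Real.cosh_abs,
    Real.cosh_eq, id]
  have := Real.exp_pos (-(a * t))
  have := Real.exp_pos (a * t)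
  linarith

/-- A law whose moments grow at most like `r! c^r` is determined by its moments. -/
theorem eq_of_moments_eq {μ ν : Measure ℝ} [IsProbabilityMeasure μ] [IsProbabilityMeasure ν] {c : ℝ}
    (hc : 0 < c) (hμ : ∀ r : ℕ, 0 < r → Integrable (fun t : ℝ => t ^ r) μ)
    (hν : ∀ r : ℕ, 0 < r → Integrable (fun t : ℝ => t ^ r) ν)
    (hmom : ∀ r : ℕ, 0 < r → ∫ t, t ^ r ∂μ ≤ r ! * c ^ r)
    (heq : ∀ r : ℕ, 0 < r → ∫ t, t ^ r ∂μ = ∫ t, t ^ r ∂ν) : μ = ν := by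
  -- Both complex moment generating functions are analytic on this strip and have the moments as
  -- derivatives at 0. They agree near 0, hence on the connected strip, which contains the imaginary
  -- axis, where they are the characteristic functions.
  set U : Set ℂ := Complex.re ⁻¹' Ioo (-(c⁻¹)) c⁻¹ with hU
  have hUc : Convex ℝ U := (convex_Ioo _ _).linear_preimage Complex.reLm
  have hc' : 0 < c⁻¹ := inv_pos.2 hc
  have h0U : ∀ z : ℂ, z.re = 0 → z ∈ U := fun z hz => by
    simp only [hU, mem_preimage, hz, mem_Ioo]
    exact ⟨by linarith, hc'⟩
  have hsμ : Ioo (-(c⁻¹)) c⁻¹ ⊆ interior (integrableExpSet id μ) :=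
    interior_maximal (Ioo_subset_integrableExpSet hμ hmom hc) isOpen_Ioo
  have hsν : Ioo (-(c⁻¹)) c⁻¹ ⊆ interior (integrableExpSet id ν) :=
    interior_maximal (Ioo_subset_integrableExpSet hν (fun r hr => heq r hr ▸ hmom r hr) hc)
      isOpen_Ioo
  have hAμ : AnalyticOnNhd ℂ (complexMGF id μ) U := analyticOnNhd_complexMGF.mono fun z hz => hsμ hz
  have hAν : AnalyticOnNhd ℂ (complexMGF id ν) U := analyticOnNhd_complexMGF.mono fun z hz => hsν hz
  have hder : ∀ n, iteratedDeriv n (complexMGF id μ) 0 = iteratedDeriv n (complexMGF id ν) 0 := by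
    intro n
    rw [iteratedDeriv_complexMGF (hsμ (h0U 0 rfl)), iteratedDeriv_complexMGF (hsν (h0U 0 rfl))]
    simp only [id, zero_mul, Complex.exp_zero, mul_one, ← Complex.ofReal_pow]
    rw [integral_complex_ofReal, integral_complex_ofReal]
    rcases n.eq_zero_or_pos with rfl | h
    · simp
    · rw [heq n h]
  have hloc : complexMGF id μ =ᶠ[nhds 0] complexMGF id ν := by
    have h1 := (hAμ 0 (h0U 0 rfl)).hasFPowerSeriesAt
    have h2 := (hAν 0 (h0U 0 rfl)).hasFPowerSeriesAt
    simp_rw [hder] at h1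
    filter_upwards [h1.eventually_hasSum_sub, h2.eventually_hasSum_sub] with z hz1 hz2
      using hz1.unique hz2
  have hEq := hAμ.eqOn_of_preconnected_of_eventuallyEq hAν hUc.isPreconnected (h0U 0 rfl) hloc
  refine Measure.ext_of_charFun ?_
  ext t
  rw [← complexMGF_id_mul_I, ← complexMGF_id_mul_I]
  exact hEq (h0U _ (by simp))

/-! ### Arcs and spanned subtrees -/

section Geometry

variable {T : Type*} [MetricSpace T]

theorem IsRealTree.notMem_arc (hT : IsRealTree T) {x y z : T} (h : dist x y < dist x z) :
    z ∉ arc x y := fun hz => absurd (hT.dist_le_of_mem_arc hz).1 (not_le.2 h)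

theorem IsRealTree.isClosed_arc (hT : IsRealTree T) (x y : T) : IsClosed (arc x y) :=
  (hT.isCompact_arc x y).isClosed

theorem IsRealTree.isPreconnected_arc (hT : IsRealTree T) (x y : T) : IsPreconnected (arc x y) := by
  obtain ⟨F, hc, -, -, -, h⟩ := hT.exists_geodesic x y
  rw [h]
  exact isPreconnected_Icc.image _ hc.continuousOn

/-- The relation `y ∈ ⟦root, x⟧` is closed. -/
theorem IsRealTree.isClosed_setOf_mem_arc (hT : IsRealTree T) (root : T) :
    IsClosed {p : T × T | p.2 ∈ arc root p.1} := by
  rw [← isOpen_compl_iff, isOpen_iff_mem_nhds]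
  rintro ⟨x, y⟩ hxy
  have hxy' : y ∉ arc root x := hxy
  have hne : 0 < dist x y := dist_pos.2 fun h => hxy' (h ▸ hT.right_mem_arc root x)
  -- A path from the root to x' lies in ⟦root, x⟧ ∪ ⟦x, x'⟧, and the second piece stays within d(x,
  -- x') of x, hence misses y' on this neighbourhood.
  have ho : IsOpen {p : T × T | p.2 ∈ (arc root x)ᶜ ∧ dist x p.1 < dist x p.2} :=
    ((hT.isClosed_arc root x).isOpen_compl.preimage continuous_snd).inter
      (isOpen_lt (continuous_const.dist continuous_fst) (continuous_const.dist continuous_snd))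
  refine Filter.mem_of_superset (ho.mem_nhds ⟨hxy', by simpa using hne⟩) ?_
  rintro ⟨x', y'⟩ ⟨h1, h2⟩ h3
  rcases hT.arc_subset root x x' h3 with h | h
  · exact h1 h
  · exact hT.notMem_arc h2 h

/-- The skeleton is covered by the arcs from the root to the points of a dense set. -/
theorem IsRealTree.exists_mem_arc_of_dense (hT : IsRealTree T) (root : T) {D : Set T}
    (hD : Dense D) {z : T} (hz : z ∈ skeleton T) : ∃ d ∈ D, z ∈ arc root d := by
  -- Otherwise the paths from the root would connect the complement of `z`, making `z` a leaf. A
  -- dense point closer to `y` than `z` is then also separated from the root by `z`.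
  have hy : ∃ y, y ≠ z ∧ z ∈ arc root y := by
    by_contra! h
    refine hz (show IsPreconnected ({z}ᶜ : Set T) from ?_)
    refine isPreconnected_of_forall root fun y hyz => ?_
    exact ⟨arc root y, fun w hw hwz => h y hyz (hwz ▸ hw), hT.left_mem_arc _ _,
      hT.right_mem_arc _ _, hT.isPreconnected_arc _ _⟩
  obtain ⟨y, hyz, hzy⟩ := hy
  obtain ⟨d, hd, hdist⟩ := hD.exists_dist_lt y (dist_pos.2 hyz)
  refine ⟨d, hd, ?_⟩
  rcases hT.arc_subset root d y hzy with h | h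
  · exact h
  · exact absurd (hT.dist_le_of_mem_arc h).2
      (not_le.2 (by rwa [dist_comm d y, dist_comm z y]))

theorem spannedSubtree_empty (root : T) : spannedSubtree root ∅ = ∅ := by simp [spannedSubtree]

theorem spannedSubtree_insert (root x : T) (S : Set T) :
    spannedSubtree root (insert x S) = arc root x ∪ spannedSubtree root S := by
  simp [spannedSubtree]

theorem arc_eq_spannedSubtree (root x : T) : arc root x = spannedSubtree root {x} := by
  simp [spannedSubtree]

theorem IsRealTree.isClosed_spannedSubtree (hT : IsRealTree T) (root : T) {S : Set T}
    (hS : S.Finite) : IsClosed (spannedSubtree root S) :=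
  hS.isClosed_biUnion fun x _ => hT.isClosed_arc root x

variable [MeasurableSpace T] [BorelSpace T]

theorem IsRealTree.lengthMeasure_spannedSubtree_ne_top (hT : IsRealTree T) (root : T) {S : Set T}
    (hS : S.Finite) : lengthMeasure T (spannedSubtree root S) ≠ ∞ := by
  refine ((measure_biUnion_lt_top hS fun x _ => ?_).ne)
  rw [lengthMeasure_arc hT]
  exact edist_lt_top _ _

theorem markIntensity_prod (α : ℝ) (A : Set T) (B : Set ℝ≥0) :
    markIntensity T α (A ×ˢ B) = ENNReal.ofReal (2 * α) * (lengthMeasure T A * halfLine B) := by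
  rw [markIntensity, Measure.smul_apply, smul_eq_mul]
  congr 1
  exact Measure.prod_prod (ν := halfLine) A B

end Geometry

/-! ### Tuples -/

theorem image_Iic_castSucc {T : Type*} {r : ℕ} (x : Fin (r + 1) → T) (i : Fin r) :
    x '' Iic i.castSucc = Fin.init x '' Iic i := by
  ext y
  simp only [mem_image, mem_Iic]
  constructor
  · rintro ⟨j, hj, rfl⟩
    have hj' : (j : ℕ) < r := lt_of_le_of_lt (Fin.le_def.1 hj) i.2
    exact ⟨⟨j, hj'⟩, Fin.le_def.2 (Fin.le_def.1 hj), rfl⟩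
  · rintro ⟨j, hj, rfl⟩
    exact ⟨j.castSucc, Fin.castSucc_le_castSucc_iff.2 hj, rfl⟩

theorem image_Iic_last {T : Type*} {r : ℕ} (x : Fin (r + 1) → T) :
    x '' Iic (Fin.last r) = range x := by
  have : Iic (Fin.last r) = univ := by ext i; simp [Fin.le_last]
  rw [this, image_univ]

theorem range_eq_insert_last {T : Type*} {r : ℕ} (x : Fin (r + 1) → T) :
    range x = insert (x (Fin.last r)) (range (Fin.init x)) := by
  ext y
  simp only [mem_range, mem_insert_iff]
  constructor
  · rintro ⟨i, rfl⟩
    refine Fin.lastCases (Or.inl rfl) (fun j => Or.inr ⟨j, rfl⟩) i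
  · rintro (rfl | ⟨j, rfl⟩)
    · exact ⟨_, rfl⟩
    · exact ⟨j.castSucc, rfl⟩

theorem measurable_fin_init {T : Type*} [MeasurableSpace T] {r : ℕ} :
    Measurable fun x : Fin (r + 1) → T => (Fin.init x : Fin r → T) :=
  measurable_pi_lambda _ fun i => measurable_pi_apply i.castSucc

theorem lintegral_pi_succ {T : Type*} [MeasurableSpace T] (m : Measure T) [SigmaFinite m] {r : ℕ}
    {f : T → (Fin r → T) → ℝ≥0∞} (hf : Measurable (Function.uncurry f)) :
    ∫⁻ x : Fin (r + 1) → T, f (x (Fin.last r)) (Fin.init x) ∂(Measure.pi fun _ => m)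
      = ∫⁻ y, ∫⁻ x, f y x ∂(Measure.pi fun _ => m) ∂m := by
  have h := (measurePreserving_piFinSuccAbove (fun _ : Fin (r + 1) => m) (Fin.last r)).lintegral_comp
    hf
  rw [lintegral_prod _ hf.aemeasurable] at h
  refine Eq.trans (lintegral_congr fun x => ?_) h
  simp [MeasurableEquiv.piFinSuccAbove, Fin.insertNthEquiv, Function.uncurry]

/-! ### Void probabilities of a Poisson point measure -/

section Poisson

variable {Ω E : Type*} [MeasurableSpace Ω] [MeasurableSpace E] {M : Ω → Measure E} {μ : Measure E}
  {P : Measure Ω}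

theorem IsPoissonPointMeasure.measurable_apply (hM : IsPoissonPointMeasure M μ P) {B : Set E}
    (hB : MeasurableSet B) : Measurable fun ω => M ω B :=
  (Measure.measurable_coe hB).comp hM.measurable

theorem IsPoissonPointMeasure.measure_apply_eq_zero (hM : IsPoissonPointMeasure M μ P) {B : Set E}
    (hB : MeasurableSet B) (hμ : μ B ≠ ∞) :
    P {ω | M ω B = 0} = ENNReal.ofReal (Real.exp (-(μ B).toReal)) := by
  have h := congrArg (fun ν => ν {0}) (hM.law B hB hμ)
  rw [Measure.map_apply (hM.measurable_apply hB) (measurableSet_singleton _),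
    Measure.map_apply (by fun_prop) (measurableSet_singleton _)] at h
  have e : (fun k : ℕ => (k : ℝ≥0∞)) ⁻¹' {0} = {0} := by ext; simp
  rw [e, poissonMeasure_singleton] at h
  simpa [preimage, ENNReal.coe_toNNReal_eq_toReal] using h

theorem IsPoissonPointMeasure.ae_apply_ne_top (hM : IsPoissonPointMeasure M μ P) {B : Set E}
    (hB : MeasurableSet B) (hμ : μ B ≠ ∞) : ∀ᵐ ω ∂P, M ω B ≠ ∞ := by
  have h := congrArg (fun ν => ν {∞}) (hM.law B hB hμ)
  rw [Measure.map_apply (hM.measurable_apply hB) (measurableSet_singleton _),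
    Measure.map_apply (by fun_prop) (measurableSet_singleton _)] at h
  have e : (fun k : ℕ => (k : ℝ≥0∞)) ⁻¹' {∞} = ∅ := by ext; simp
  rw [e, measure_empty] at h
  simpa [ae_iff, preimage] using h

theorem IsPoissonPointMeasure.ae_apply_eq_zero [IsProbabilityMeasure P]
    (hM : IsPoissonPointMeasure M μ P) {B : Set E} (hB : MeasurableSet B) (hμ : μ B = 0) :
    ∀ᵐ ω ∂P, M ω B = 0 := by
  have h := hM.measure_apply_eq_zero hB (by simp [hμ])
  rw [hμ] at h
  refine (prob_compl_eq_zero_iff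
    (hM.measurable_apply hB (measurableSet_singleton 0))).2 ?_
  simpa [preimage] using h

/-- Whether a random measure charges the sections of a measurable set is jointly measurable, where
the random measure is normalised so that no finiteness is needed. -/
theorem measurableSet_section_null {X : Type*} [MeasurableSpace X] {N : Ω → Measure E}
    (hN : Measurable N) {C : Set (X × E)} (hC : MeasurableSet C) :
    MeasurableSet {p : X × Ω | (N p.2 univ)⁻¹ * N p.2 (Prod.mk p.1 ⁻¹' C) = 0} := by
  let κ : Kernel (X × Ω) E := ⟨fun p => (N p.2 univ)⁻¹ • N p.2, by
    refine Measure.measurable_of_measurable_coe _ fun s hs => ?_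
    simp only [Measure.smul_apply, smul_eq_mul]
    exact (((Measure.measurable_coe .univ).comp (hN.comp measurable_snd)).inv).mul
      ((Measure.measurable_coe hs).comp (hN.comp measurable_snd))⟩
  have hκ : IsFiniteKernel κ := ⟨1, ENNReal.one_lt_top, fun p => by
    change (N p.2 univ)⁻¹ * N p.2 univ ≤ 1
    exact ENNReal.inv_mul_le_one _⟩
  have ht : MeasurableSet {q : (X × Ω) × E | (q.1.1, q.2) ∈ C} :=
    (measurable_fst.fst.prodMk measurable_snd) hC
  exact Kernel.measurable_kernel_prodMk_left (κ := κ) ht (measurableSet_singleton 0)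

end Poisson

/-! ### Marks on the tree and measurability of the void events -/

section Marks

variable {T : Type*} [MetricSpace T] [MeasurableSpace T]

/-- Writing θ as a length instead of an infimum makes it an integral over levels, to which Fubini
applies. -/
theorem theta_eq_halfLine (root : T) (M : Measure (T × ℝ≥0)) (x : T) :
    theta root M x = halfLine {t | M (arc root x ×ˢ Iic t) = 0} := by
  have h : IsLowerSet {t | M (arc root x ×ˢ Iic t) = 0} := fun t u h ht =>
    measure_mono_null (prod_mono_right (Iic_subset_Iic.2 h)) ht
  rw [halfLine_lowerSet h]
  simp [theta, pos_iff_ne_zero]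

variable [BorelSpace T]

theorem markIntensity_spannedSubtree_ne_top (hT : IsRealTree T) (root : T) (α : ℝ) {S : Set T}
    (hS : S.Finite) (t : ℝ≥0) : markIntensity T α (spannedSubtree root S ×ˢ Iic t) ≠ ∞ := by
  rw [markIntensity_prod, halfLine_Iic]
  have := hT.lengthMeasure_spannedSubtree_ne_top root hS
  finiteness

variable [CompactSpace T]

/-- Up to a null event, the event that there is no mark on `⟦root, x⟧ × [0, t]` is jointly
measurable in `x`, `t` and the randomness. -/
theorem exists_measurableSet_noMark (hT : IsRealTree T) (root : T) (α : ℝ) {Ω : Type*}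
    [MeasurableSpace Ω] {P : Measure Ω} [IsProbabilityMeasure P] {M : Ω → Measure (T × ℝ≥0)}
    (hM : IsPoissonPointMeasure M (markIntensity T α) P) :
    ∃ W : Set ((T × ℝ≥0) × Ω), MeasurableSet W ∧
      ∀ᵐ ω ∂P, ∀ x t, ((x, t), ω) ∈ W ↔ M ω (arc root x ×ˢ Iic t) = 0 := by
  have : Nonempty T := ⟨root⟩
  -- The total intensity may be infinite, so `M` is cut into the countably many windows `Q j n`,
  -- each of finite intensity. The arcs `K j` cover the skeleton, so the rest `Z` has no length and
  -- almost surely no mark: one null event serves all x and t.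
  let K : ℕ → Set T := fun j => arc root (TopologicalSpace.denseSeq T j)
  let Q : ℕ → ℕ → Set (T × ℝ≥0) := fun j n => K j ×ˢ Iic (n : ℝ≥0)
  have hK : ∀ j, MeasurableSet (K j) := fun j => (hT.isClosed_arc _ _).measurableSet
  have hQ : ∀ j n, MeasurableSet (Q j n) := fun j n => (hK j).prod measurableSet_Iic
  have hQtop : ∀ j n, markIntensity T α (Q j n) ≠ ∞ := fun j n => by
    simp only [Q, K, arc_eq_spannedSubtree]
    exact markIntensity_spannedSubtree_ne_top hT root α (finite_singleton _) _
  let Z : Set T := (⋃ j, K j)ᶜ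
  have hZ : MeasurableSet Z := (MeasurableSet.iUnion hK).compl
  have hZ0 : lengthMeasure T Z = 0 := by
    rw [lengthMeasure, Measure.restrict_apply hZ]
    refine measure_mono_null (t := ∅) ?_ measure_empty
    rintro z ⟨hz, hs⟩
    refine hz ?_
    obtain ⟨_, ⟨j, rfl⟩, hj⟩ :=
      hT.exists_mem_arc_of_dense root (TopologicalSpace.denseRange_denseSeq T) hs
    exact mem_iUnion.2 ⟨j, hj⟩
  have hae1 : ∀ᵐ ω ∂P, ∀ j n, M ω (Q j n) ≠ ∞ :=
    ae_all_iff.2 fun j => ae_all_iff.2 fun n => hM.ae_apply_ne_top (hQ j n) (hQtop j n)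
  have hae2 : ∀ᵐ ω ∂P, M ω (Z ×ˢ univ) = 0 :=
    hM.ae_apply_eq_zero (hZ.prod .univ) (by rw [markIntensity_prod, hZ0, zero_mul, mul_zero])
  let C : Set ((T × ℝ≥0) × (T × ℝ≥0)) := {p | p.2.1 ∈ arc root p.1.1 ∧ p.2.2 ≤ p.1.2}
  have hC : MeasurableSet C := by
    refine MeasurableSet.inter ?_ (measurableSet_le (by fun_prop) (by fun_prop))
    exact (measurable_fst.fst.prodMk measurable_snd.fst)
      (hT.isClosed_setOf_mem_arc root).measurableSet
  have hCsec : ∀ x t, Prod.mk (x, t) ⁻¹' C = arc root x ×ˢ Iic t := fun x t => rfl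
  have hN : ∀ j n, Measurable fun ω => (M ω).restrict (Q j n) := fun j n =>
    Measure.measurable_of_measurable_coe _ fun s hs => by
      simp only [Measure.restrict_apply hs]
      exact hM.measurable_apply (hs.inter (hQ j n))
  -- In `W` the mass of every window is normalised; where that mass is finite the factor is nonzero
  -- and does not affect nullity.
  refine ⟨⋂ j, ⋂ n, _, MeasurableSet.iInter fun j => MeasurableSet.iInter fun n =>
    measurableSet_section_null (hN j n) hC, ?_⟩
  filter_upwards [hae1, hae2] with ω h1 h2 x t
  simp only [mem_iInter, mem_ofPred_eq, hCsec]
  have hA : MeasurableSet (arc root x ×ˢ Iic t) :=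
    (hT.isClosed_arc root x).measurableSet.prod measurableSet_Iic
  simp only [Measure.restrict_apply hA, Measure.restrict_apply_univ, mul_eq_zero,
    ENNReal.inv_eq_zero, h1, false_or]
  refine ⟨fun h => ?_, fun h j n => measure_mono_null inter_subset_left h⟩
  refine measure_mono_null (t := (Z ×ˢ univ) ∪ ⋃ j, ⋃ n, (arc root x ×ˢ Iic t) ∩ Q j n) ?_
    (measure_union_null h2 (measure_iUnion_null fun j => measure_iUnion_null fun n => h j n))
  rintro ⟨y, u⟩ hyu
  by_cases hy : y ∈ ⋃ j, K j
  · obtain ⟨j, hj⟩ := mem_iUnion.1 hy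
    obtain ⟨n, hn⟩ := exists_nat_ge u
    exact Or.inr (mem_iUnion₂.2 ⟨j, n, hyu, hj, hn⟩)
  · exact Or.inl ⟨hy, trivial⟩

end Marks

/-! ### Iterated integrals -/

section Chain

variable {T Ω : Type*} [MeasurableSpace T] [MeasurableSpace Ω]

/-- The measure of the `(t_1, …, t_r)` with `s < t_r < ⋯ < t_1` such that `((x_i, t_i), ω) ∈ W`
for all `i`. -/
noncomputable def chain (W : Set ((T × ℝ≥0) × Ω)) : (r : ℕ) → (Fin r → T) → ℝ≥0 → Ω → ℝ≥0∞
  | 0 => fun _ _ _ => 1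
  | r + 1 => fun x s ω => ∫⁻ t in Ioi s,
      W.indicator 1 ((x (Fin.last r), t), ω) * chain W r (Fin.init x) t ω ∂halfLine

theorem measurable_chain {W : Set ((T × ℝ≥0) × Ω)} (hW : MeasurableSet W) (r : ℕ) :
    Measurable fun p : (Fin r → T) × ℝ≥0 × Ω => chain W r p.1 p.2.1 p.2.2 := by
  induction r with
  | zero => exact measurable_const
  | succ r ih =>
    have h : (fun p : (Fin (r + 1) → T) × ℝ≥0 × Ω => chain W (r + 1) p.1 p.2.1 p.2.2) = fun p =>
        ∫⁻ t, {q : ((Fin (r + 1) → T) × ℝ≥0 × Ω) × ℝ≥0 | q.1.2.1 < q.2}.indicator (fun q =>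
          W.indicator 1 ((q.1.1 (Fin.last r), q.2), q.1.2.2) *
            chain W r (Fin.init q.1.1) q.2 q.1.2.2) (p, t) ∂halfLine := by
      ext p
      simp only [chain]
      rw [← lintegral_indicator measurableSet_Ioi]
      rfl
    rw [h]
    refine Measurable.lintegral_prod_right' (Measurable.indicator ?_
      (measurableSet_lt (by fun_prop) (by fun_prop)))
    refine Measurable.mul ?_ ?_
    · exact (measurable_one.indicator hW).comp (g := W.indicator (1 : (T × ℝ≥0) × Ω → ℝ≥0∞))
        (f := fun q : ((Fin (r + 1) → T) × ℝ≥0 × Ω) × ℝ≥0 =>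
          ((q.1.1 (Fin.last r), q.2), q.1.2.2)) (by fun_prop)
    · exact ih.comp (g := fun p : (Fin r → T) × ℝ≥0 × Ω => chain W r p.1 p.2.1 p.2.2)
        (f := fun q : ((Fin (r + 1) → T) × ℝ≥0 × Ω) × ℝ≥0 => (Fin.init q.1.1, q.2, q.1.2.2))
        ((measurable_fin_init.comp measurable_fst.fst).prodMk (by fun_prop))

theorem measurable_indicator_section {W : Set ((T × ℝ≥0) × Ω)} (hW : MeasurableSet W) (ω : Ω) :
    Measurable fun p : T × ℝ≥0 => W.indicator (1 : (T × ℝ≥0) × Ω → ℝ≥0∞) (p, ω) :=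
  (measurable_one.indicator hW).comp (measurable_id.prodMk measurable_const)

/-- The powers of an integral over `(s, ∞)` as iterated integrals. -/
theorem setLIntegral_pow_eq_lintegral_chain (m : Measure T) [SigmaFinite m]
    {W : Set ((T × ℝ≥0) × Ω)} (hW : MeasurableSet W) (ω : Ω) (r : ℕ) (s : ℝ≥0) :
    (∫⁻ t in Ioi s, ∫⁻ y, W.indicator 1 ((y, t), ω) ∂m ∂halfLine) ^ r
      = r ! * ∫⁻ x, chain W r x s ω ∂(Measure.pi fun _ => m) := by
  set Y : ℝ≥0 → ℝ≥0∞ := fun t => ∫⁻ y, W.indicator 1 ((y, t), ω) ∂m with hY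
  have hYm : Measurable Y := (measurable_indicator_section hW ω).lintegral_prod_left'
  -- The integral to be raised to a power is ρ(s, ∞), so `measure_Ioi_pow_succ` peels off its
  -- smallest level.
  set ρ := halfLine.withDensity Y
  have : NullSingletonClass ρ := inferInstance
  have hρ : ∀ s, ρ (Ioi s) = ∫⁻ t in Ioi s, Y t ∂halfLine := fun s =>
    withDensity_apply _ measurableSet_Ioi
  have hI : Measurable fun t => ρ (Ioi t) :=
    Antitone.measurable fun a b h => measure_mono (Ioi_subset_Ioi h)
  induction r generalizing s with
  | zero => simp [chain]
  | succ r ih =>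
    simp_rw [← hρ] at ih ⊢
    rw [measure_Ioi_pow_succ, setLIntegral_withDensity_eq_setLIntegral_mul _ hYm (hI.pow_const r)
      measurableSet_Ioi]
    have hch : ∀ t, Measurable fun x => chain W r x t ω := fun t =>
      (measurable_chain hW r).comp (g := fun p : (Fin r → T) × ℝ≥0 × Ω => chain W r p.1 p.2.1 p.2.2)
        (f := fun x => (x, t, ω)) (by fun_prop)
    have hg : Measurable fun q : (T × (Fin r → T)) × ℝ≥0 =>
        W.indicator 1 ((q.1.1, q.2), ω) * chain W r q.1.2 q.2 ω := by
      refine Measurable.mul ?_ ?_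
      · exact (measurable_indicator_section hW ω).comp
          (f := fun q : (T × (Fin r → T)) × ℝ≥0 => (q.1.1, q.2)) (by fun_prop)
      · exact (measurable_chain hW r).comp
          (g := fun p : (Fin r → T) × ℝ≥0 × Ω => chain W r p.1 p.2.1 p.2.2)
          (f := fun q : (T × (Fin r → T)) × ℝ≥0 => (q.1.2, q.2, ω)) (by fun_prop)
    have hstep : ∀ t, (Y * fun t => ρ (Ioi t) ^ r) t = r ! * ∫⁻ q : T × (Fin r → T),
        W.indicator 1 ((q.1, t), ω) * chain W r q.2 t ω ∂(m.prod (Measure.pi fun _ => m)) := by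
      intro t
      rw [Pi.mul_apply, ih, lintegral_prod_mul (f := fun y => W.indicator 1 ((y, t), ω))
        (g := fun x => chain W r x t ω) ?_ (hch t).aemeasurable]
      · simp only [hY]
        ring
      · exact ((measurable_indicator_section hW ω).comp
          (f := fun y => (y, t)) (by fun_prop)).aemeasurable
    simp_rw [hstep]
    rw [lintegral_const_mul' _ _ (by finiteness), ← mul_assoc, Nat.factorial_succ]
    push_cast
    congr 1
    rw [lintegral_lintegral_swap (f := fun t (q : T × (Fin r → T)) =>
      W.indicator 1 ((q.1, t), ω) * chain W r q.2 t ω) (hg.comp measurable_swap).aemeasurable,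
      lintegral_prod _ (hg.lintegral_prod_right' ).aemeasurable, ← lintegral_pi_succ]
    · rfl
    · exact hg.lintegral_prod_right'

end Chain

/-! ### The moments of `Θ` -/

section Moments

variable {T : Type*} [MetricSpace T] [MeasurableSpace T]

theorem ae_Theta_eq {Ω : Type*} [MeasurableSpace Ω] {P : Measure Ω}
    {M : Ω → Measure (T × ℝ≥0)} (root : T) (m : Measure T) [IsFiniteMeasure m]
    {W : Set ((T × ℝ≥0) × Ω)} (hW : MeasurableSet W)
    (hWM : ∀ᵐ ω ∂P, ∀ x t, ((x, t), ω) ∈ W ↔ M ω (arc root x ×ˢ Iic t) = 0) :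
    ∀ᵐ ω ∂P, Theta root m (M ω)
      = ∫⁻ t in Ioi 0, ∫⁻ y, W.indicator 1 ((y, t), ω) ∂m ∂halfLine := by
  filter_upwards [hWM] with ω hω
  have h0 : halfLine.restrict (Ioi 0) = halfLine := by
    have : (Ici (0 : ℝ≥0)) = univ := by ext; simp
    rw [Measure.restrict_congr_set Ioi_ae_eq_Ici, this, Measure.restrict_univ]
  rw [h0, ← lintegral_lintegral_swap (f := fun y t => W.indicator 1 ((y, t), ω))
    (measurable_indicator_section hW ω).aemeasurable]
  refine lintegral_congr fun x => ?_
  have hm : MeasurableSet {t : ℝ≥0 | ((x, t), ω) ∈ W} :=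
    (measurable_prodMk_left.prodMk measurable_const) hW
  rw [theta_eq_halfLine]
  simp_rw [← hω]
  rw [← lintegral_indicator_one hm]
  rfl

variable [BorelSpace T]

/-- As `D` lies below level `s`, raising the level to `t` adds only a slab over (s, t], so the
intensity is affine in `t`. -/
theorem markIntensity_union_spannedSubtree (hT : IsRealTree T) (root : T) {α : ℝ} {S : Set T}
    (hS : S.Finite) {s t : ℝ≥0} (hst : s ≤ t) {D : Set (T × ℝ≥0)} (hDs : D ⊆ univ ×ˢ Iic s) :
    markIntensity T α (D ∪ spannedSubtree root S ×ˢ Iic t)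
      = markIntensity T α (D ∪ spannedSubtree root S ×ˢ Iic s)
        + ENNReal.ofReal (2 * α) * lengthMeasure T (spannedSubtree root S) * (t - s : ℝ≥0) := by
  have h : D ∪ spannedSubtree root S ×ˢ Iic t
      = (D ∪ spannedSubtree root S ×ˢ Iic s) ∪ spannedSubtree root S ×ˢ Ioc s t := by
    rw [union_assoc, ← prod_union, Iic_union_Ioc_eq_Iic hst]
  have hd : Disjoint (D ∪ spannedSubtree root S ×ˢ Iic s) (spannedSubtree root S ×ˢ Ioc s t) := by
    refine Disjoint.mono_left (union_subset hDs (prod_mono_left (subset_univ _))) ?_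
    refine Disjoint.set_prod_right ?_ _ _
    exact (Iic_disjoint_Ioc le_rfl)
  rw [h, measure_union hd ((hT.isClosed_spannedSubtree root hS).measurableSet.prod measurableSet_Ioc),
    markIntensity_prod, halfLine_Ioc, mul_assoc]

theorem jansonMoment_eq (hT : IsRealTree T) (root : T) (m : Measure T) {α : ℝ} (hα : 0 < α)
    (r : ℕ) : jansonMoment root m α r = r ! * ∫⁻ x : Fin r → T, ∏ i, (ENNReal.ofReal (2 * α) *
      lengthMeasure T (spannedSubtree root (x '' Iic i)))⁻¹ ∂(Measure.pi fun _ => m) := by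
  have hα' : ENNReal.ofReal (2 * α) ≠ 0 := (ENNReal.ofReal_pos.2 (by linarith)).ne'
  have h : ∀ x : Fin r → T, ∏ i, (ENNReal.ofReal (2 * α) *
      lengthMeasure T (spannedSubtree root (x '' Iic i)))⁻¹
      = (ENNReal.ofReal (2 * α) ^ r)⁻¹ *
        (1 / ∏ i, lengthMeasure T (spannedSubtree root (x '' Iic i))) := by
    intro x
    -- Finiteness excludes products 0 · ∞, for which inversion is not multiplicative.
    have hl : ∀ i, lengthMeasure T (spannedSubtree root (x '' Iic i)) ≠ ∞ := fun i =>
      hT.lengthMeasure_spannedSubtree_ne_top root (toFinite _)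
    simp_rw [ENNReal.mul_inv (Or.inl hα') (Or.inl ENNReal.ofReal_ne_top)]
    rw [Finset.prod_mul_distrib, Finset.prod_const, Finset.card_univ, Fintype.card_fin, one_div,
      ENNReal.inv_pow, ENNReal.prod_inv_distrib fun i _ j _ _ => Or.inr (hl j)]
  simp_rw [h]
  rw [lintegral_const_mul' _ _ (ENNReal.inv_ne_top.2 (pow_ne_zero _ hα')), jansonMoment,
    div_eq_mul_inv, mul_assoc]

theorem jansonMoment_le (hT : IsRealTree T) (root : T) (m : Measure T) [IsFiniteMeasure m]
    {α : ℝ} (hα : 0 < α) (r : ℕ) :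
    jansonMoment root m α r ≤ r ! * jansonMoment root m α 1 ^ r := by
  have hdm : Measurable fun y => (ENNReal.ofReal (2 * α) * edist root y)⁻¹ := by fun_prop
  have h : ∀ r : ℕ, ∫⁻ x : Fin r → T, ∏ i, (ENNReal.ofReal (2 * α) * edist root (x i))⁻¹
      ∂(Measure.pi fun _ => m) = (∫⁻ y, (ENNReal.ofReal (2 * α) * edist root y)⁻¹ ∂m) ^ r :=
    fun r => by
      induction r with
      | zero => simp
      | succ r ih =>
        have hg : Measurable fun x : Fin r → T =>
            ∏ i, (ENNReal.ofReal (2 * α) * edist root (x i))⁻¹ :=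
          Finset.measurable_prod _ fun i _ => hdm.comp (measurable_pi_apply i)
        have hs := lintegral_pi_succ m (r := r) (f := fun y x =>
          (ENNReal.ofReal (2 * α) * edist root y)⁻¹ *
            ∏ i, (ENNReal.ofReal (2 * α) * edist root (x i))⁻¹)
          ((hdm.comp measurable_fst).mul (hg.comp measurable_snd))
        simp_rw [lintegral_const_mul _ hg, lintegral_mul_const _ hdm, ih] at hs
        rw [pow_succ', ← hs]
        refine lintegral_congr fun x => ?_
        rw [Fin.prod_univ_castSucc, mul_comm]
        rfl
  have h1 : jansonMoment root m α 1 = ∫⁻ y, (ENNReal.ofReal (2 * α) * edist root y)⁻¹ ∂m := by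
    rw [← pow_one (∫⁻ y, _ ∂m), ← h 1, jansonMoment_eq hT root m hα]
    simp only [Nat.factorial_one, Nat.cast_one, one_mul]
    refine lintegral_congr fun x => Finset.prod_congr rfl fun i _ => ?_
    have : x '' Iic i = {x i} := by
      ext y
      simp [Subsingleton.elim _ i]
    rw [this, ← arc_eq_spannedSubtree, lengthMeasure_arc hT]
  rw [jansonMoment_eq hT root m hα, h1, ← h]
  gcongr with x i
  rw [← lengthMeasure_arc hT]
  exact measure_mono (subset_biUnion_of_mem (u := arc root) (mem_image_of_mem x (mem_Iic.2 le_rfl)))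

variable {Ω : Type*} [MeasurableSpace Ω] {P : Measure Ω}
  {M : Ω → Measure (T × ℝ≥0)}

variable [IsProbabilityMeasure P]

/-- The mean of an iterated integral of the event that there is no mark, on the event that there
is no mark on a given set below the first level. -/
theorem lintegral_indicator_mul_chain (hT : IsRealTree T) (root : T) {α : ℝ}
    (hM : IsPoissonPointMeasure M (markIntensity T α) P) {W : Set ((T × ℝ≥0) × Ω)}
    (hW : MeasurableSet W)
    (hWM : ∀ᵐ ω ∂P, ∀ x t, ((x, t), ω) ∈ W ↔ M ω (arc root x ×ˢ Iic t) = 0)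
    (r : ℕ) (x : Fin r → T) (s : ℝ≥0) {D : Set (T × ℝ≥0)} (hD : MeasurableSet D)
    (hDs : D ⊆ univ ×ˢ Iic s) (hDμ : markIntensity T α D ≠ ∞) :
    ∫⁻ ω, {ω | M ω D = 0}.indicator 1 ω * chain W r x s ω ∂P
      = ENNReal.ofReal (Real.exp (-(markIntensity T α
          (D ∪ spannedSubtree root (range x) ×ˢ Iic s)).toReal))
        * ∏ i, (ENNReal.ofReal (2 * α) * lengthMeasure T (spannedSubtree root (x '' Iic i)))⁻¹ := by
  -- The last point has the smallest level t, and its condition is absorbed into the void event by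
  -- replacing `D` with D ∪ ⟦root, y⟧ × [0, t], which lies below t, the new starting level.
  induction r generalizing s D with
  | zero =>
    have hDm : MeasurableSet {ω | M ω D = 0} := hM.measurable_apply hD (measurableSet_singleton 0)
    simp only [chain, mul_one, range_eq_empty, spannedSubtree_empty, empty_prod, union_empty,
      Finset.univ_eq_empty, Finset.prod_empty]
    rw [lintegral_indicator_one hDm, hM.measure_apply_eq_zero hD hDμ]
  | succ r ih =>
    have hDm : MeasurableSet {ω | M ω D = 0} := hM.measurable_apply hD (measurableSet_singleton 0)
    set y := x (Fin.last r)
    set z : Fin r → T := Fin.init x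
    set c := ∏ i, (ENNReal.ofReal (2 * α) * lengthMeasure T (spannedSubtree root (z '' Iic i)))⁻¹
    have hA : MeasurableSet (arc root y) := (hT.isClosed_arc root y).measurableSet
    have hmeas : Measurable fun p : Ω × ℝ≥0 =>
        {ω | M ω D = 0}.indicator 1 p.1 * (W.indicator 1 ((y, p.2), p.1) * chain W r z p.2 p.1) := by
      refine ((measurable_one.indicator hDm).comp measurable_fst).mul (Measurable.mul ?_ ?_)
      · exact (measurable_one.indicator hW).comp (g := W.indicator (1 : (T × ℝ≥0) × Ω → ℝ≥0∞))
          (f := fun p : Ω × ℝ≥0 => ((y, p.2), p.1)) (by fun_prop)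
      · exact (measurable_chain hW r).comp
          (g := fun p : (Fin r → T) × ℝ≥0 × Ω => chain W r p.1 p.2.1 p.2.2)
          (f := fun p : Ω × ℝ≥0 => (z, p.2, p.1)) (by fun_prop)
    have h1 : ∀ ω, {ω | M ω D = 0}.indicator 1 ω * chain W (r + 1) x s ω
        = ∫⁻ t in Ioi s, {ω | M ω D = 0}.indicator 1 ω *
          (W.indicator 1 ((y, t), ω) * chain W r z t ω) ∂halfLine := by
      intro ω
      rw [lintegral_const_mul' _ _ (by simp only [indicator]; split_ifs <;> simp)]
      rfl
    have h2 : ∀ t ∈ Ioi s, ∫⁻ ω, {ω | M ω D = 0}.indicator 1 ω *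
          (W.indicator 1 ((y, t), ω) * chain W r z t ω) ∂P
        = ENNReal.ofReal (Real.exp (-(markIntensity T α
          (D ∪ spannedSubtree root (range x) ×ˢ Iic t)).toReal)) * c := by
      intro t ht
      have hst : s ≤ t := le_of_lt ht
      have hsets : D ∪ spannedSubtree root (range x) ×ˢ Iic t
          = (D ∪ arc root y ×ˢ Iic t) ∪ spannedSubtree root (range z) ×ˢ Iic t := by
        rw [range_eq_insert_last, spannedSubtree_insert, union_prod, union_assoc]
      rw [hsets, ← ih z t (hD.union (hA.prod measurableSet_Iic))]
      · refine lintegral_congr_ae ?_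
        filter_upwards [hWM] with ω hω
        rw [← mul_assoc]
        congr 1
        simp only [indicator, mem_ofPred_eq, hω, measure_union_null_iff, Pi.one_apply]
        split_ifs <;> simp_all
      · exact union_subset (hDs.trans (prod_mono_right (Iic_subset_Iic.2 hst)))
          (prod_mono_left (subset_univ _))
      · refine ((measure_union_le _ _).trans_lt (ENNReal.add_lt_top.2 ⟨hDμ.lt_top, ?_⟩)).ne
        rw [arc_eq_spannedSubtree]
        exact (markIntensity_spannedSubtree_ne_top hT root α (finite_singleton _) t).lt_top
    simp_rw [h1]
    rw [lintegral_lintegral_swap (f := fun ω t => {ω | M ω D = 0}.indicator 1 ω *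
      (W.indicator 1 ((y, t), ω) * chain W r z t ω)) hmeas.aemeasurable,
      setLIntegral_congr_fun measurableSet_Ioi h2]
    have hfin := finite_range x
    have ha : markIntensity T α (D ∪ spannedSubtree root (range x) ×ˢ Iic s) ≠ ∞ :=
      ((measure_union_le _ _).trans_lt (ENNReal.add_lt_top.2 ⟨hDμ.lt_top,
        (markIntensity_spannedSubtree_ne_top hT root α hfin s).lt_top⟩)).ne
    have hb : ENNReal.ofReal (2 * α) * lengthMeasure T (spannedSubtree root (range x)) ≠ ∞ :=
      ENNReal.mul_ne_top ENNReal.ofReal_ne_top (hT.lengthMeasure_spannedSubtree_ne_top root hfin)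
    have hprod : ∏ i, (ENNReal.ofReal (2 * α) *
        lengthMeasure T (spannedSubtree root (x '' Iic i)))⁻¹
        = c * (ENNReal.ofReal (2 * α) * lengthMeasure T (spannedSubtree root (range x)))⁻¹ := by
      rw [Fin.prod_univ_castSucc, image_Iic_last]
      simp_rw [image_Iic_castSucc]
      rfl
    -- The exponent has slope 2α ℓ(T(x_1, …, x_(r+1))) in t; integrating over t > s creates the last
    -- factor of the product.
    have hμ : ∀ t ∈ Ioi s, ENNReal.ofReal (Real.exp (-(markIntensity T α
          (D ∪ spannedSubtree root (range x) ×ˢ Iic t)).toReal)) * c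
        = ENNReal.ofReal (Real.exp (-((
          (markIntensity T α (D ∪ spannedSubtree root (range x) ×ˢ Iic s)).toNNReal +
          (ENNReal.ofReal (2 * α) * lengthMeasure T (spannedSubtree root (range x))).toNNReal
            * (t - s) : ℝ≥0) : ℝ))) * c := by
      intro t ht
      rw [markIntensity_union_spannedSubtree hT root hfin (le_of_lt ht) hDs,
        ENNReal.toReal_add ha (ENNReal.mul_ne_top hb ENNReal.coe_ne_top), ENNReal.toReal_mul (a := _ * _)]
      rfl
    rw [setLIntegral_congr_fun measurableSet_Ioi hμ, lintegral_mul_const _ (by fun_prop),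
      setLIntegral_exp_neg_Ioi, hprod, ENNReal.coe_toNNReal hb, mul_assoc, mul_comm c]
    rfl

variable [CompactSpace T]

theorem lintegral_Theta_pow (hT : IsRealTree T) (root : T) (m : Measure T) [IsFiniteMeasure m]
    {α : ℝ} (hα : 0 < α) (hM : IsPoissonPointMeasure M (markIntensity T α) P) (r : ℕ) :
    ∫⁻ ω, Theta root m (M ω) ^ r ∂P = jansonMoment root m α r := by
  obtain ⟨W, hW, hWM⟩ := exists_measurableSet_noMark hT root α hM
  have h1 : ∀ᵐ ω ∂P, Theta root m (M ω) ^ r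
      = r ! * ∫⁻ x, chain W r x 0 ω ∂(Measure.pi fun _ => m) := by
    filter_upwards [ae_Theta_eq root m hW hWM] with ω hω
    rw [hω, setLIntegral_pow_eq_lintegral_chain m hW]
  have hch : Measurable fun p : Ω × (Fin r → T) => chain W r p.2 0 p.1 :=
    (measurable_chain hW r).comp (g := fun p : (Fin r → T) × ℝ≥0 × Ω => chain W r p.1 p.2.1 p.2.2)
      (f := fun p : Ω × (Fin r → T) => (p.2, 0, p.1)) (by fun_prop)
  rw [lintegral_congr_ae h1, lintegral_const_mul' _ _ (by finiteness),
    lintegral_lintegral_swap (f := fun ω x => chain W r x 0 ω) hch.aemeasurable,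
    jansonMoment_eq hT root m hα]
  congr 1
  refine lintegral_congr fun x => ?_
  -- With `D` empty and starting level 0 the exponential is 1 and only the product remains.
  have h2 := lintegral_indicator_mul_chain hT root hM hW hWM r x 0 MeasurableSet.empty
    (empty_subset _) (by simp)
  have h3 : markIntensity T α (spannedSubtree root (range x) ×ˢ Iic 0) = 0 := by
    rw [markIntensity_prod, halfLine_Iic, ENNReal.coe_zero, mul_zero, mul_zero]
  simpa [h3] using h2

theorem aemeasurable_Theta (hT : IsRealTree T) (root : T) (m : Measure T) [IsFiniteMeasure m]
    {α : ℝ} (hM : IsPoissonPointMeasure M (markIntensity T α) P) :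
    AEMeasurable (fun ω => Theta root m (M ω)) P := by
  obtain ⟨W, hW, hWM⟩ := exists_measurableSet_noMark hT root α hM
  refine ⟨_, ?_, ae_Theta_eq root m hW hWM⟩
  have h : Measurable fun q : (Ω × ℝ≥0) × T => W.indicator (1 : (T × ℝ≥0) × Ω → ℝ≥0∞)
      ((q.2, q.1.2), q.1.1) :=
    (measurable_one.indicator hW).comp (g := W.indicator (1 : (T × ℝ≥0) × Ω → ℝ≥0∞))
      (f := fun q : (Ω × ℝ≥0) × T => ((q.2, q.1.2), q.1.1)) (by fun_prop)
  exact h.lintegral_prod_right'.lintegral_prod_right'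

end Moments

end RealTree

/-! ### Moments and characterization of the law of Θ -/

theorem mainTheorem1 {T : Type*} [MetricSpace T] [CompactSpace T] [MeasurableSpace T]
    [BorelSpace T] (hT : RealTree.IsRealTree T) (root : T) (m : Measure T) [IsFiniteMeasure m]
    (α : ℝ) (hα : 0 < α) {Ω : Type*} [MeasurableSpace Ω] (P : Measure Ω) [IsProbabilityMeasure P]
    (M : Ω → Measure (T × ℝ≥0))
    (hM : RealTree.IsPoissonPointMeasure M (RealTree.markIntensity T α) P) :
    AEMeasurable (fun ω => RealTree.Theta root m (M ω)) P ∧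
    (∀ r : ℕ, 0 < r →
      ∫⁻ ω, RealTree.Theta root m (M ω) ^ r ∂P = RealTree.jansonMoment root m α r) ∧
    (RealTree.jansonMoment root m α 1 ≠ ∞ →
      (∀ᵐ ω ∂P, RealTree.Theta root m (M ω) < ∞) ∧
      ∀ ν : Measure ℝ, RealTree.IsJansonLaw root m α ν ↔
        ν = P.map (fun ω => (RealTree.Theta root m (M ω)).toReal)) := by
  have hmeas := RealTree.aemeasurable_Theta hT root m hM
  have hmom := RealTree.lintegral_Theta_pow hT root m hα hM
  refine ⟨hmeas, fun r _ => hmom r, fun hfin => ?_⟩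
  have hle := RealTree.jansonMoment_le hT root m hα
  have hne : ∀ r, RealTree.jansonMoment root m α r ≠ ∞ := fun r =>
    ne_top_of_le_ne_top (by finiteness) (hle r)
  have hlt : ∀ᵐ ω ∂P, RealTree.Theta root m (M ω) < ∞ := by
    refine ae_lt_top' hmeas ?_
    simpa [← hmom 1] using hne 1
  refine ⟨hlt, ?_⟩
  have hreal := hmeas.ennreal_toReal
  have hlaw : RealTree.IsJansonLaw root m α
      (P.map fun ω => (RealTree.Theta root m (M ω)).toReal) := by
    have hint : ∀ r : ℕ, Integrable (fun ω => (RealTree.Theta root m (M ω)).toReal ^ r) P := by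
      intro r
      simp_rw [← ENNReal.toReal_pow]
      exact integrable_toReal_of_lintegral_ne_top (hmeas.pow_const r) (by rw [hmom]; exact hne r)
    refine ⟨Measure.isProbabilityMeasure_map hreal, fun r _ => hne r, fun r _ => ?_, fun r _ => ?_⟩
    · exact (integrable_map_measure (by fun_prop) hreal).2 (hint r)
    · rw [integral_map hreal (by fun_prop)]
      simp_rw [← ENNReal.toReal_pow]
      rw [integral_toReal (hmeas.pow_const r), hmom]
      filter_upwards [hlt] with ω hω
      exact ENNReal.pow_lt_top hω
  refine fun ν => ⟨fun hν => ?_, fun hν => hν ▸ hlaw⟩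
  have := hν.isProbabilityMeasure
  have := hlaw.isProbabilityMeasure
  -- The added 1 keeps the constant positive: μ_1 vanishes when `m` = 0.
  refine RealTree.eq_of_moments_eq (c := (RealTree.jansonMoment root m α 1).toReal + 1)
    (by positivity) hν.integrable hlaw.integrable (fun r hr => ?_)
    fun r hr => (hν.moment_eq r hr).trans (hlaw.moment_eq r hr).symm
  rw [hν.moment_eq r hr]
  have h := ENNReal.toReal_mono (by finiteness) (hle r)
  rw [ENNReal.toReal_mul, ENNReal.toReal_natCast, ENNReal.toReal_pow] at h
  refine h.trans ?_
  gcongr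
  linarith
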